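/- Let $k,n\ge 1$ be integers, put $N=\max(n,2)$, and let $e_r$ be the $r$-th coordinate vector of $\mathbb{R}^k$. Let $X_1,\dots,X_N$ be 1-dependent (that is, $\sigma(X_1,\dots,X_a)$ and $\sigma(X_b,\dots,X_N)$ are independent whenever $b-a>1$), identically distributed random vectors with values in $\{0,e_1,\dots,e_k\}$ almost surely, such that the joint law of $(X_i,X_{i+1})$ does not depend on $i$. Write $p_r=P(X_1=e_r)\in(0,1)$ and $p_{rj}=P(X_1=e_r,\,X_2=e_j)$, and assume that $$\max_{1\le j\le k}p_j\le\frac1{144k},\qquad \sum_{m=1}^k(p_{mj}+p_{jm})\le\frac{p_j}{5}\quad(j=1,\dots,k).$$ Let $F_n$ be the distribution of $S_n=X_1+\dots+X_n$, and let $\mathrm{Pois}(\lambda)$, $\lambda=(np_1,\dots,np_k)$, be the distribution on $\mathbb{Z}^k$ of a vector with independent coordinates whose $j$-th coordinate has the Poisson distribution with parameter $np_j$. Put $$\gamma_j=\max(1,\sqrt{np_j}),\qquad \varepsilon_1=\sum_{r,j=1}^k\frac{p_{rj}+p_rp_j}{\gamma_r\gamma_j},$$ and for a finite signed measure $M$ on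 $\mathbb{Z}^k$ let $\|M\|_\infty=\sup_{m\in\mathbb{Z}^k}|M\{m\}|$ and $\|M\|_\alpha=\bigl(\sum_{m\in\mathbb{Z}^k}|M\{m\}|^\alpha\bigr)^{1/\alpha}$ for real $\alpha\geq 1$. Then there is a constant $C(k)>0$ depending only on $k$ and, for every real $\alpha\ge2$, a constant $C(k,\alpha)>0$ depending only on $k$ and $\alpha$, such that in all such situations $$\|F_n-\mathrm{Pois}(\lambda)\|_\infty\le C(k)\,n\,\varepsilon_1\prod_{j=1}^k\gamma_j^{-1},\qquad \|F_n-\mathrm{Pois}(\lambda)\|_\alpha\le C(k,\alpha)\,n\,\varepsilon_1\prod_{j=1}^k\gamma_j^{-(\alpha-1)/\alpha}.$$ -/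

import Mathlib

open MeasureTheory ProbabilityTheory
open scoped ENNReal NNReal

noncomputable section

namespace MultiPoisson

/-- The local norm `sup_m |M{m}|` of a finite signed measure on `ℤ^k`. -/
def localNorm {k : ℕ} (M : SignedMeasure (Fin k → ℤ)) : ℝ≥0∞ :=
  ⨆ m : Fin k → ℤ, ‖M {m}‖ₑ

/-- The `ℓ_α` norm `(∑_m |M{m}|^α)^{1/α}` of a finite signed measure on `ℤ^k`. -/
def lNorm {k : ℕ} (α : ℝ) (M : SignedMeasure (Fin k → ℤ)) : ℝ≥0∞ :=
  (∑' m : Fin k → ℤ, ‖M {m}‖ₑ ^ α) ^ (1 / α)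

/-- The `k`-dimensional Poisson law on `ℤ^k`: independent coordinates, the `j`-th one Poisson
with parameter `lam j`. -/
def pois {k : ℕ} (lam : Fin k → ℝ≥0) : Measure (Fin k → ℤ) :=
  Measure.pi fun j => (poissonMeasure (lam j)).map (fun s : ℕ => (s : ℤ))

instance pois_isFiniteMeasure {k : ℕ} (lam : Fin k → ℝ≥0) : IsFiniteMeasure (pois lam) := by
  unfold pois; infer_instance

section Sequence

variable {Ω : Type*} [MeasurableSpace Ω] {k : ℕ}

/-- `X 0, …, X (N - 1)` (the vectors `X_1, …, X_N`) are 1-dependent: the past up to time `a` and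
the future from time `b` on are independent whenever `b - a > 1`. -/
def IsOneDependent (μ : Measure Ω) (X : ℕ → Ω → Fin k → ℤ) (N : ℕ) : Prop :=
  ∀ a b : ℕ, a + 1 < b → b < N →
    Indep (⨆ i ∈ Set.Iic a, MeasurableSpace.comap (X i) inferInstance)
      (⨆ i ∈ Set.Ico b N, MeasurableSpace.comap (X i) inferInstance) μ

/-- `p_r = P(X_1 = e_r)`. -/
def p1 (μ : Measure Ω) (X : ℕ → Ω → Fin k → ℤ) (r : Fin k) : ℝ :=
  μ.real {ω | X 0 ω = Pi.single r 1}

/-- `p_{rj} = P(X_1 = e_r, X_2 = e_j)`. -/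
def p2 (μ : Measure Ω) (X : ℕ → Ω → Fin k → ℤ) (r j : Fin k) : ℝ :=
  μ.real {ω | X 0 ω = Pi.single r 1 ∧ X 1 ω = Pi.single j 1}

/-- `X_1, …, X_N` are 1-dependent identically distributed random vectors concentrated on
`0, e_1, …, e_k`, with `p_r ∈ (0,1)`, and the joint law of two consecutive vectors does not depend
on their position. -/
structure IsModel (μ : Measure Ω) (X : ℕ → Ω → Fin k → ℤ) (N : ℕ) : Prop where
  measurable : ∀ i < N, Measurable (X i)
  oneDependent : IsOneDependent μ X N
  identDistrib : ∀ i < N, IdentDistrib (X i) (X 0) μ μ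
  identDistrib_pair : ∀ i, i + 1 < N →
    IdentDistrib (fun ω => (X i ω, X (i + 1) ω)) (fun ω => (X 0 ω, X 1 ω)) μ μ
  values : ∀ᵐ ω ∂μ, X 0 ω = 0 ∨ ∃ r : Fin k, X 0 ω = Pi.single r 1
  p1_mem : ∀ r, p1 μ X r ∈ Set.Ioo (0 : ℝ) 1

/-- The smallness conditions `max_j p_j ≤ 1/(144k)` and `∑_m (p_{mj} + p_{jm}) ≤ p_j/5`. -/
def SmallnessCond (μ : Measure Ω) (X : ℕ → Ω → Fin k → ℤ) : Prop :=
  (∀ j, p1 μ X j ≤ 1 / (144 * (k : ℝ))) ∧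
    ∀ j, ∑ m, (p2 μ X m j + p2 μ X j m) ≤ p1 μ X j / 5

/-- `γ_j = max(1, √(n p_j))`. -/
def gam (μ : Measure Ω) (X : ℕ → Ω → Fin k → ℤ) (n : ℕ) (j : Fin k) : ℝ :=
  max 1 (Real.sqrt (n * p1 μ X j))

/-- `ε_1 = ∑_{r,j} (p_{rj} + p_r p_j) / (γ_r γ_j)`. -/
def eps1 (μ : Measure Ω) (X : ℕ → Ω → Fin k → ℤ) (n : ℕ) : ℝ :=
  ∑ r, ∑ j, (p2 μ X r j + p1 μ X r * p1 μ X j) / (gam μ X n r * gam μ X n j)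

/-- `F_n`, the distribution of `S_n = X_1 + ⋯ + X_n`. -/
def sumLaw (μ : Measure Ω) (X : ℕ → Ω → Fin k → ℤ) (n : ℕ) : Measure (Fin k → ℤ) :=
  μ.map (fun ω => ∑ i ∈ Finset.range n, X i ω)

instance sumLaw_isFiniteMeasure (μ : Measure Ω) [IsFiniteMeasure μ] (X : ℕ → Ω → Fin k → ℤ) (n : ℕ) :
    IsFiniteMeasure (sumLaw μ X n) := by
  unfold sumLaw; infer_instance

/-- The signed measure `F_n - Pois(λ)` with `λ = (n p_1, …, n p_k)`. -/
def poissonError (μ : Measure Ω) [IsFiniteMeasure μ] (X : ℕ → Ω → Fin k → ℤ) (n : ℕ) :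
    SignedMeasure (Fin k → ℤ) :=
  (sumLaw μ X n).toSignedMeasure -
    (pois fun j => (n * p1 μ X j).toNNReal).toSignedMeasure

end Sequence

end MultiPoisson

end

/-!
The proof compares characteristic functions. Let `z_r = exp (2πi t_r) - 1`,
`Q = ∑ p_r |z_r|²`, `a = ∑ p_r |z_r|` and `b = ∑ p_{rj} |z_r| |z_j|`. The heart of the matter is the
bound `|F̂_n(t) - Pois^(t)| ≤ 40 n (b + a²) exp (-n Q / 5)` (`IsModel.norm_ft_sub_le`).

With `Z_i = exp (2πi ⟨X_i, t⟩) - 1` the partial sums have characteristic functions `f_j = E ∏_{i<j} (1 + Z_i)`.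
Expanding the last factors until one of them contributes `1` (`prod_one_add_succ`), 1-dependence gives
`f_{j+1} = f_j + ∑_{s ≤ j} f_{s-1} E[Z_s ⋯ Z_j]`, where `f_{-1} = 1`, which truncated subtraction
provides since `f_0 = 1`. The moments decay geometrically in the length of
the block, since every other factor can be bounded by `2` and the remaining ones are then independent
(`IsModel.integral_prod_Ico_le`). By strong induction the ratio `f_{j+1} / f_j` is `1 + w` with
`w = E Z_0`, up to an error of order `b + a²` (`norm_sub_one_add_mul_le`). The smallness conditions make
this error less than `0.29 Q`, while `|1 + w| ≤ 1 - 0.49 Q`, so `|f_j|` is damped by `exp (-j Q / 5)`;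
telescoping against the powers of `exp w` gives the bound (`norm_sub_exp_le`).

Part of the damping turns each factor `|z_r|` into `O(1 / γ_r)`, which yields
`O(n ε₁ exp (-n Q / 10))` (`IsModel.norm_ft_sub_le_eps1`). The exponential has integral
`O(∏ γ_j⁻¹)` over the torus (`integral_exp_neg_sum_le`). Fourier inversion now bounds the local norm,
Parseval's identity the `ℓ_2` norm (`hasSum_sq_sub`), and for `α ≥ 2` the `ℓ_α` norm is interpolated
between the two (`lNorm_le_of_abs_le_of_hasSum_sq`).
-/

namespace MultiPoisson

/-! ### Fourier analysis on the integer lattice -/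

/-- The character `m ↦ exp (2πi ⟨m, t⟩)` of `ℤ^k` with frequency vector `t`. -/
noncomputable def chi {k : ℕ} (m : Fin k → ℤ) (t : Fin k → ℝ) : ℂ :=
  Complex.exp ((2 * Real.pi * ∑ j, m j * t j : ℝ) * Complex.I)

/-- Lebesgue measure on the cube `(-1/2, 1/2]^k`, a fundamental domain of the torus. -/
noncomputable def cube (k : ℕ) : Measure (Fin k → ℝ) :=
  Measure.pi fun _ => volume.restrict (Set.Ioc (-1 / 2 : ℝ) (1 / 2))

instance : IsProbabilityMeasure (volume.restrict (Set.Ioc (-1 / 2 : ℝ) (1 / 2))) :=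
  ⟨by rw [Measure.restrict_apply_univ, Real.volume_Ioc]; norm_num⟩

instance (k : ℕ) : IsProbabilityMeasure (cube k) := by unfold cube; infer_instance

section chi

variable {k : ℕ}

lemma norm_chi (m : Fin k → ℤ) (t : Fin k → ℝ) : ‖chi m t‖ = 1 :=
  Complex.norm_exp_ofReal_mul_I _

lemma chi_zero (t : Fin k → ℝ) : chi 0 t = 1 := by simp [chi]

lemma chi_add (m m' : Fin k → ℤ) (t : Fin k → ℝ) : chi (m + m') t = chi m t * chi m' t := by
  rw [chi, chi, chi, ← Complex.exp_add]
  congr 1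
  push_cast [Pi.add_apply]
  simp only [add_mul, Finset.sum_add_distrib, mul_add]

lemma chi_sum {ι : Type*} (s : Finset ι) (m : ι → Fin k → ℤ) (t : Fin k → ℝ) :
    chi (∑ i ∈ s, m i) t = ∏ i ∈ s, chi (m i) t := by
  classical
  induction s using Finset.induction_on with
  | empty => simp [chi_zero]
  | insert a s ha ih => rw [Finset.sum_insert ha, Finset.prod_insert ha, chi_add, ih]

lemma conj_chi (m : Fin k → ℤ) (t : Fin k → ℝ) : (starRingEnd ℂ) (chi m t) = chi (-m) t := by
  rw [chi, chi, ← Complex.exp_conj]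
  congr 1
  rw [map_mul, Complex.conj_I, Complex.conj_ofReal]
  simp [Finset.sum_neg_distrib]

lemma chi_eq_prod (m : Fin k → ℤ) (t : Fin k → ℝ) :
    chi m t = ∏ j, Complex.exp (m j * (2 * Real.pi * t j * Complex.I)) := by
  rw [chi, ← Complex.exp_sum]
  congr 1
  push_cast
  rw [Finset.mul_sum, Finset.sum_mul]
  exact Finset.sum_congr rfl fun j _ => by ring

lemma chi_single (r : Fin k) (t : Fin k → ℝ) :
    chi (Pi.single r 1) t = Complex.exp (2 * Real.pi * t r * Complex.I) := by
  rw [chi_eq_prod, Finset.prod_eq_single r]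
  · simp
  · intro b _ hb
    simp [Pi.single_eq_of_ne hb]
  · simp

@[fun_prop]
lemma continuous_chi (m : Fin k → ℤ) : Continuous (chi m) := by unfold chi; fun_prop

lemma measurable_chi : Measurable fun p : (Fin k → ℤ) × (Fin k → ℝ) => chi p.1 p.2 :=
  measurable_from_prod_countable_right fun m => (continuous_chi m).measurable

lemma integral_exp_int (n : ℤ) :
    ∫ t in Set.Ioc (-1 / 2 : ℝ) (1 / 2), Complex.exp (n * (2 * Real.pi * t * Complex.I)) =
      if n = 0 then 1 else 0 := by
  rw [← intervalIntegral.integral_of_le (by norm_num)]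
  split_ifs with h
  · subst h; norm_num
  · have hc : (n * (2 * Real.pi * Complex.I) : ℂ) ≠ 0 := by
      simp [h, Real.pi_ne_zero]
    have := integral_exp_mul_complex (a := -1 / 2) (b := 1 / 2) hc
    rw [show (∫ t in (-1 / 2 : ℝ)..1 / 2, Complex.exp (n * (2 * Real.pi * t * Complex.I))) =
      ∫ t in (-1 / 2 : ℝ)..1 / 2, Complex.exp (n * (2 * Real.pi * Complex.I) * t) by
        congr 1; ext t; congr 1; ring, this, div_eq_zero_iff]
    left
    rw [sub_eq_zero, Complex.exp_eq_exp_iff_exists_int]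
    exact ⟨n, by push_cast; ring⟩

/-- Orthogonality of the characters. -/
lemma integral_chi (m : Fin k → ℤ) : ∫ t, chi m t ∂cube k = if m = 0 then 1 else 0 := by
  simp_rw [chi_eq_prod]
  rw [cube, integral_fintype_prod_eq_prod
    (f := fun j (s : ℝ) => Complex.exp (m j * (2 * Real.pi * s * Complex.I)))]
  simp_rw [integral_exp_int]
  split_ifs with h
  · simp [h]
  · obtain ⟨j, hj⟩ := Function.ne_iff.mp h
    exact Finset.prod_eq_zero (Finset.mem_univ j) (if_neg hj)

end chi

section Fourier

variable {k : ℕ}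

/-- The characteristic function `t ↦ ∫ exp (2πi ⟨m, t⟩) dν(m)` of a measure on `ℤ^k`. -/
noncomputable def ft (ν : Measure (Fin k → ℤ)) (t : Fin k → ℝ) : ℂ := ∫ m, chi m t ∂ν

lemma stronglyMeasurable_ft (ν : Measure (Fin k → ℤ)) [SFinite ν] : StronglyMeasurable (ft ν) :=
  StronglyMeasurable.integral_prod_left' (f := fun p : (Fin k → ℤ) × (Fin k → ℝ) => chi p.1 p.2)
    measurable_chi.stronglyMeasurable

lemma measurable_ft_sub (ν ν' : Measure (Fin k → ℤ)) [SFinite ν] [SFinite ν'] :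
    Measurable fun t => ft ν t - ft ν' t :=
  (stronglyMeasurable_ft ν).measurable.sub (stronglyMeasurable_ft ν').measurable

variable (ν : Measure (Fin k → ℤ)) [IsProbabilityMeasure ν]

lemma norm_ft_le (t : Fin k → ℝ) : ‖ft ν t‖ ≤ 1 := by
  refine (norm_integral_le_of_norm_le_const (C := 1) (.of_forall fun m => (norm_chi m t).le)).trans ?_
  simp

/-- Fubini: pairing a bounded function with the characteristic function of a measure. -/
lemma integral_mul_ft (g : (Fin k → ℝ) → ℂ) (hg : Measurable g) {C : ℝ} (hC : ∀ t, ‖g t‖ ≤ C) :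
    ∫ t, g t * ft ν t ∂cube k = ∫ m, ∫ t, g t * chi m t ∂cube k ∂ν := by
  simp_rw [ft, ← integral_const_mul]
  refine integral_integral_swap ?_
  refine Integrable.of_bound (C := C) ?_ (.of_forall fun p => ?_)
  · exact ((hg.comp measurable_fst).mul (measurable_chi.comp measurable_swap)).aestronglyMeasurable
  · simp only [Function.uncurry, norm_mul, norm_chi, mul_one]
    exact hC _

/-- Fourier inversion on `ℤ^k`. -/
lemma integral_chi_mul_ft (m : Fin k → ℤ) :
    ∫ t, chi (-m) t * ft ν t ∂cube k = (ν.real {m} : ℂ) := by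
  rw [integral_mul_ft ν _ (continuous_chi _).measurable (fun t => (norm_chi _ t).le)]
  simp_rw [← chi_add, integral_chi, neg_add_eq_zero]
  have : (fun m' : Fin k → ℤ => if m = m' then (1 : ℂ) else 0) = ({m} : Set _).indicator 1 := by
    ext m'; simp [Set.indicator_apply, eq_comm]
  rw [this, integral_indicator (measurableSet_singleton m)]
  simp [measureReal_def]

variable (ν' : Measure (Fin k → ℤ)) [IsProbabilityMeasure ν']

lemma norm_ft_sub_le (t : Fin k → ℝ) : ‖ft ν t - ft ν' t‖ ≤ 2 :=
  (norm_sub_le _ _).trans (by linarith [norm_ft_le ν t, norm_ft_le ν' t])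

lemma integral_chi_mul_ft_sub (m : Fin k → ℤ) :
    ∫ t, chi (-m) t * (ft ν t - ft ν' t) ∂cube k = ((ν.real {m} - ν'.real {m} : ℝ) : ℂ) := by
  simp_rw [mul_sub]
  have hi : ∀ (ν : Measure (Fin k → ℤ)) [IsProbabilityMeasure ν],
      Integrable (fun t => chi (-m) t * ft ν t) (cube k) := fun ν _ =>
    Integrable.of_bound ((continuous_chi _).measurable.mul
      (stronglyMeasurable_ft ν).measurable).aestronglyMeasurable 1
      (.of_forall fun t => by rw [norm_mul, norm_chi, one_mul]; exact norm_ft_le ν t)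
  rw [integral_sub (hi ν) (hi ν'), integral_chi_mul_ft, integral_chi_mul_ft]
  push_cast; rfl

lemma abs_sub_le_integral_norm_ft (m : Fin k → ℤ) :
    |ν.real {m} - ν'.real {m}| ≤ ∫ t, ‖ft ν t - ft ν' t‖ ∂cube k := by
  rw [← Real.norm_eq_abs, ← Complex.norm_real, ← integral_chi_mul_ft_sub]
  refine (norm_integral_le_integral_norm _).trans (le_of_eq ?_)
  simp_rw [norm_mul, norm_chi, one_mul]

/-- Parseval's identity for the difference of two probability measures on `ℤ^k`. -/
lemma hasSum_sq_sub : HasSum (fun m => (ν.real {m} - ν'.real {m}) ^ 2)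
    (∫ t, ‖ft ν t - ft ν' t‖ ^ 2 ∂cube k) := by
  set M : (Fin k → ℤ) → ℝ := fun m => ν.real {m} - ν'.real {m} with hM
  set Φ : (Fin k → ℝ) → ℂ := fun t => ft ν t - ft ν' t with hΦ
  have hΦm : Measurable Φ := measurable_ft_sub ν ν'
  have hcm : Measurable fun t => (starRingEnd ℂ) (Φ t) := Complex.continuous_conj.measurable.comp hΦm
  have hcb : ∀ t, ‖(starRingEnd ℂ) (Φ t)‖ ≤ 2 := fun t => by
    rw [RCLike.norm_conj]; exact norm_ft_sub_le ν ν' t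
  have hMb : ∀ m, ‖M m‖ ≤ 1 := fun m => by
    rw [Real.norm_eq_abs, abs_le]
    constructor <;> simp only [hM] <;>
      linarith [measureReal_nonneg (μ := ν) (s := {m}), measureReal_nonneg (μ := ν') (s := {m}),
        measureReal_le_one (μ := ν) (s := {m}), measureReal_le_one (μ := ν') (s := {m})]
  have hMi : ∀ (κ : Measure (Fin k → ℤ)) [IsProbabilityMeasure κ], Integrable M κ := fun κ _ =>
    Integrable.of_bound (Measurable.of_discrete).aestronglyMeasurable 1 (.of_forall hMb)
  have hinner : ∀ m, ∫ t, (starRingEnd ℂ) (Φ t) * chi m t ∂cube k = (M m : ℂ) := fun m => by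
    have := congrArg (starRingEnd ℂ) (integral_chi_mul_ft_sub ν ν' m)
    rw [← integral_conj, Complex.conj_ofReal] at this
    rw [← this]
    refine integral_congr_ae (.of_forall fun t => ?_)
    simp only [map_mul, conj_chi, neg_neg]
    exact mul_comm _ _
  have hpair : ∀ (κ : Measure (Fin k → ℤ)) [IsProbabilityMeasure κ],
      ∫ t, (starRingEnd ℂ) (Φ t) * ft κ t ∂cube k = ((∫ m, M m ∂κ : ℝ) : ℂ) := fun κ _ => by
    rw [integral_mul_ft κ _ hcm hcb, ← integral_complex_ofReal]
    exact integral_congr_ae (.of_forall hinner)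
  have hi : ∀ (κ : Measure (Fin k → ℤ)) [IsProbabilityMeasure κ],
      Integrable (fun t => (starRingEnd ℂ) (Φ t) * ft κ t) (cube k) := fun κ _ =>
    Integrable.of_bound (hcm.mul (stronglyMeasurable_ft κ).measurable).aestronglyMeasurable 2
      (.of_forall fun t => by
        rw [norm_mul]
        nlinarith [hcb t, norm_ft_le κ t, norm_nonneg ((starRingEnd ℂ) (Φ t)),
          norm_nonneg (ft κ t)])
  have hsum : ∀ (κ : Measure (Fin k → ℤ)) [IsProbabilityMeasure κ],
      HasSum (fun m => κ.real {m} * M m) (∫ m, M m ∂κ) := fun κ _ => by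
    have h := hMi κ
    rw [← Measure.sum_smul_dirac κ] at h
    have h' := hasSum_integral_measure h
    rw [Measure.sum_smul_dirac] at h'
    simpa [integral_smul_measure, measureReal_def] using h'
  have key : ∫ t, ‖Φ t‖ ^ 2 ∂cube k = ∫ m, M m ∂ν - ∫ m, M m ∂ν' := by
    have : ((∫ t, ‖Φ t‖ ^ 2 ∂cube k : ℝ) : ℂ) = ((∫ m, M m ∂ν - ∫ m, M m ∂ν' : ℝ) : ℂ) := by
      rw [Complex.ofReal_sub, ← hpair ν, ← hpair ν', ← integral_sub (hi ν) (hi ν'),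
        ← integral_complex_ofReal]
      refine integral_congr_ae (.of_forall fun t => ?_)
      simp only [← mul_sub]
      rw [← Complex.normSq_eq_conj_mul_self, Complex.normSq_eq_norm_sq]
    exact_mod_cast this
  rw [key]
  simp_rw [pow_two]
  simpa only [← sub_mul] using (hsum ν).sub (hsum ν')

end Fourier

section Poisson

variable {k : ℕ}

lemma integral_exp_poissonMeasure (r : ℝ≥0) (s : ℝ) :
    ∫ m : ℤ, Complex.exp (m * (2 * Real.pi * s * Complex.I))
        ∂((poissonMeasure r).map (fun s : ℕ => (s : ℤ))) =
      Complex.exp (r * (Complex.exp (2 * Real.pi * s * Complex.I) - 1)) := by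
  rw [integral_map .of_discrete .of_discrete]
  have := charFun_map_cast_poissonMeasure r (2 * Real.pi * s)
  rw [charFun_apply, integral_map .of_discrete (by fun_prop)] at this
  convert this using 3 with n
  · simp; ring_nf
  · push_cast; rfl

/-- The characteristic function of the multivariate Poisson law. -/
lemma ft_pois (lam : Fin k → ℝ≥0) (t : Fin k → ℝ) :
    ft (pois lam) t = Complex.exp (∑ j, lam j * (chi (Pi.single j 1) t - 1)) := by
  simp_rw [ft, chi_eq_prod _ t, pois]
  rw [integral_fintype_prod_eq_prod
    (f := fun j (m : ℤ) => Complex.exp (m * (2 * Real.pi * t j * Complex.I)))]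
  simp_rw [integral_exp_poissonMeasure, ← chi_eq_prod, chi_single]
  rw [Complex.exp_sum]

instance (lam : Fin k → ℝ≥0) : IsProbabilityMeasure (pois lam) := by
  have (j : Fin k) : IsProbabilityMeasure ((poissonMeasure (lam j)).map (fun s : ℕ => (s : ℤ))) :=
    Measure.isProbabilityMeasure_map Measurable.of_discrete.aemeasurable
  unfold pois
  infer_instance

end Poisson

section Gaussian

variable {k : ℕ}

lemma four_mul_abs_le_norm_exp_sub_one {t : ℝ} (ht : t ∈ Set.Ioc (-1 / 2 : ℝ) (1 / 2)) :
    4 * |t| ≤ ‖Complex.exp (2 * Real.pi * t * Complex.I) - 1‖ := by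
  have h := Complex.norm_exp_I_mul_ofReal_sub_one (2 * Real.pi * t)
  rw [show Complex.I * ((2 * Real.pi * t : ℝ) : ℂ) = 2 * Real.pi * t * Complex.I by
    push_cast; ring, show 2 * Real.pi * t / 2 = Real.pi * t by ring] at h
  rw [h, norm_mul, Real.norm_eq_abs, Real.norm_eq_abs, abs_two]
  have habs : |t| ≤ 1 / 2 := abs_le.2 ⟨by linarith [ht.1], ht.2⟩
  have := Real.mul_abs_le_abs_sin (x := Real.pi * t) (by
    rw [abs_mul, abs_of_pos Real.pi_pos]; nlinarith [Real.pi_pos])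
  rw [abs_mul, abs_of_pos Real.pi_pos, ← mul_assoc, div_mul_cancel₀ _ Real.pi_ne_zero] at this
  linarith

lemma integral_exp_neg_norm_sq_le {lam : ℝ} (hlam : 0 ≤ lam) :
    ∫ t in Set.Ioc (-1 / 2 : ℝ) (1 / 2),
      Real.exp (-(lam / 10 * ‖Complex.exp (2 * Real.pi * t * Complex.I) - 1‖ ^ 2)) ≤
        2 * (max 1 (Real.sqrt lam))⁻¹ := by
  have hcont : Continuous fun t : ℝ =>
      Real.exp (-(lam / 10 * ‖Complex.exp (2 * Real.pi * t * Complex.I) - 1‖ ^ 2)) := by fun_prop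
  have hint : IntegrableOn (fun t : ℝ =>
      Real.exp (-(lam / 10 * ‖Complex.exp (2 * Real.pi * t * Complex.I) - 1‖ ^ 2)))
      (Set.Ioc (-1 / 2 : ℝ) (1 / 2)) :=
    (hcont.integrableOn_Icc).mono_set Set.Ioc_subset_Icc_self
  rcases le_total (Real.sqrt lam) 1 with h | h
  · rw [max_eq_left h]
    calc _ ≤ ∫ t in Set.Ioc (-1 / 2 : ℝ) (1 / 2), (1 : ℝ) := by
          refine integral_mono hint (integrable_const _) fun t => ?_
          exact Real.exp_le_one_iff.2 (by simp only [Left.neg_nonpos_iff]; positivity)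
      _ ≤ _ := by simp; norm_num
  · rw [max_eq_right h]
    have hpos : 0 < lam := by
      by_contra hc
      rw [Real.sqrt_eq_zero_of_nonpos (not_lt.1 hc)] at h
      norm_num at h
    have hb : 0 < 8 / 5 * lam := by positivity
    calc _ ≤ ∫ t in Set.Ioc (-1 / 2 : ℝ) (1 / 2), Real.exp (-(8 / 5 * lam) * t ^ 2) := by
          refine setIntegral_mono_on hint (integrable_exp_neg_mul_sq hb).integrableOn
            measurableSet_Ioc fun t ht => Real.exp_le_exp.2 ?_
          have := four_mul_abs_le_norm_exp_sub_one ht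
          have h2 : (4 * |t|) ^ 2 ≤ ‖Complex.exp (2 * Real.pi * t * Complex.I) - 1‖ ^ 2 := by gcongr
          rw [mul_pow, sq_abs] at h2
          nlinarith
      _ ≤ ∫ t, Real.exp (-(8 / 5 * lam) * t ^ 2) :=
          setIntegral_le_integral (integrable_exp_neg_mul_sq hb)
            (.of_forall fun t => (Real.exp_pos _).le)
      _ = Real.sqrt (Real.pi / (8 / 5 * lam)) := integral_gaussian _
      _ ≤ Real.sqrt (2 ^ 2 / lam) := by
          refine Real.sqrt_le_sqrt ?_
          rw [div_le_div_iff₀ hb hpos]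
          nlinarith [Real.pi_le_four]
      _ = _ := by rw [Real.sqrt_div (by norm_num), Real.sqrt_sq (by norm_num), div_eq_mul_inv]

/-- The Gaussian-type majorant of the characteristic functions has integral `O (∏ γ_j⁻¹)`. -/
lemma integral_exp_neg_sum_le (lam : Fin k → ℝ) (hlam : ∀ j, 0 ≤ lam j) :
    ∫ t, Real.exp (-(1 / 10 * ∑ j, lam j * ‖chi (Pi.single j 1) t - 1‖ ^ 2)) ∂cube k ≤
      2 ^ k * ∏ j, (max 1 (Real.sqrt (lam j)))⁻¹ := by
  have : ∀ t : Fin k → ℝ, Real.exp (-(1 / 10 * ∑ j, lam j * ‖chi (Pi.single j 1) t - 1‖ ^ 2)) =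
      ∏ j, Real.exp (-(lam j / 10 * ‖Complex.exp (2 * Real.pi * t j * Complex.I) - 1‖ ^ 2)) := by
    intro t
    rw [← Real.exp_sum, Finset.mul_sum, ← Finset.sum_neg_distrib]
    congr 1
    exact Finset.sum_congr rfl fun j _ => by rw [chi_single]; ring
  simp_rw [this]
  rw [cube, integral_fintype_prod_eq_prod (f := fun j (s : ℝ) =>
    Real.exp (-(lam j / 10 * ‖Complex.exp (2 * Real.pi * s * Complex.I) - 1‖ ^ 2)))]
  calc _ ≤ ∏ j, 2 * (max 1 (Real.sqrt (lam j)))⁻¹ :=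
        Finset.prod_le_prod (fun j _ => integral_nonneg fun s => (Real.exp_pos _).le)
          fun j _ => integral_exp_neg_norm_sq_le (hlam j)
    _ = _ := by rw [Finset.prod_mul_distrib]; simp

end Gaussian

/-! ### Recursions with geometrically decaying memory -/

section Recursion

lemma geom_sum_two_ninths_le (j : ℕ) : ∑ i ∈ Finset.range j, (2 / 9 : ℝ) ^ i ≤ 9 / 7 := by
  rw [geom_sum_eq (by norm_num)]
  have : (0 : ℝ) ≤ (2 / 9) ^ j := by positivity
  rw [div_le_iff_of_neg (by norm_num)]
  linarith

variable {n : ℕ} {f : ℕ → ℂ} {M : ℕ → ℕ → ℂ} {w : ℂ} {a D Q : ℝ}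

/-- One step of the recursion: if the previous ratios `f (i + 1) / f i` are close to `1 + w`, they
are at least `9 / 10` in modulus, so the earlier values of `f` are at most geometrically larger than
`f j`, which the decay of the coefficients `M s j` in `j - s` outweighs. -/
lemma norm_sub_one_add_mul_le
    (hrec : ∀ j < n, f (j + 1) = f j + ∑ s ∈ Finset.range (j + 1), f (s - 1) * M s j)
    (hMw : ∀ j < n, M j j = w) (hw : ‖w‖ ≤ a)
    (hM : ∀ s j, s < j → j < n → ‖M s j‖ ≤ D * (1 / 5) ^ (j - 1 - s)) (ha : a ≤ 1 / 72)
    (hD : 8 / 5 * D + 2 * a ^ 2 ≤ 3 / 5 * a) (hD0 : 0 ≤ D) :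
    ∀ j < n, ‖f (j + 1) - (1 + w) * f j‖ ≤ (8 / 5 * D + 2 * a ^ 2) * ‖f j‖ := by
  intro j
  induction j using Nat.strong_induction_on with
  | _ j ih =>
  intro hj
  have ha0 : 0 ≤ a := (norm_nonneg _).trans hw
  have hstep : ∀ i < j, ‖f (i + 1) - f i‖ ≤ 8 / 5 * a * ‖f i‖ := fun i hi => by
    have h1 := ih i hi (hi.trans hj)
    calc ‖f (i + 1) - f i‖ = ‖(f (i + 1) - (1 + w) * f i) + w * f i‖ := by congr 1; ring
      _ ≤ (8 / 5 * D + 2 * a ^ 2) * ‖f i‖ + a * ‖f i‖ := by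
          refine (norm_add_le _ _).trans (add_le_add h1 ?_)
          rw [norm_mul]; gcongr
      _ ≤ _ := by nlinarith [norm_nonneg (f i)]
  have hratio : ∀ i < j, ‖f i‖ ≤ 10 / 9 * ‖f (i + 1)‖ := fun i hi => by
    have h1 := hstep i hi
    have h2 := norm_sub_norm_le (f i) (f (i + 1))
    rw [norm_sub_rev] at h2
    nlinarith [norm_nonneg (f i)]
  have hback : ∀ d ≤ j, ‖f (j - d)‖ ≤ (10 / 9) ^ d * ‖f j‖ := by
    intro d
    induction d with
    | zero => simp
    | succ d ihd =>
      intro hd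
      have h1 := hratio (j - (d + 1)) (by omega)
      rw [show j - (d + 1) + 1 = j - d by omega] at h1
      rw [pow_succ]
      nlinarith [ihd (by omega)]
  have hback' : ∀ s ≤ j, ‖f (s - 1)‖ ≤ (10 / 9) ^ (j - s + 1) * ‖f j‖ := by
    intro s hs
    rcases Nat.eq_zero_or_pos s with h0 | h0
    · subst h0
      have h1 := hback j le_rfl
      rw [Nat.sub_self] at h1
      refine h1.trans ?_
      gcongr
      · norm_num
      · omega
    · have h1 := hback (j - s + 1) (by omega)
      rwa [show j - (j - s + 1) = s - 1 by omega] at h1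
  -- the term `s = j` of the recursion is `w * f (j - 1)`, not `w * f j`
  have hfirst : ‖w * (f (j - 1) - f j)‖ ≤ 2 * a ^ 2 * ‖f j‖ := by
    rw [norm_mul]
    have : ‖f (j - 1) - f j‖ ≤ 2 * a * ‖f j‖ := by
      rcases Nat.eq_zero_or_pos j with h0 | h0
      · subst h0; simp only [zero_tsub, sub_self, norm_zero]; positivity
      · have h1 := hstep (j - 1) (by omega)
        have h2 := hratio (j - 1) (by omega)
        rw [show j - 1 + 1 = j by omega] at h1 h2
        rw [norm_sub_rev]
        nlinarith [norm_nonneg (f j), mul_nonneg ha0 (norm_nonneg (f j))]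
    calc ‖w‖ * ‖f (j - 1) - f j‖ ≤ a * (2 * a * ‖f j‖) := by gcongr
      _ = _ := by ring
  -- the memory of length `j - s` costs `(10 / 9) ^ (j - s + 1)` against the gain `(1 / 5) ^ (j - 1 - s)`
  have hrest : ‖∑ s ∈ Finset.range j, f (s - 1) * M s j‖ ≤ 8 / 5 * D * ‖f j‖ := by
    calc _ ≤ ∑ s ∈ Finset.range j, ‖f (s - 1) * M s j‖ := norm_sum_le _ _
      _ ≤ ∑ s ∈ Finset.range j, (100 / 81 * D * ‖f j‖) * (2 / 9) ^ (j - 1 - s) := by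
          refine Finset.sum_le_sum fun s hs => ?_
          have hs' := Finset.mem_range.1 hs
          rw [norm_mul]
          calc _ ≤ ((10 / 9) ^ (j - s + 1) * ‖f j‖) * (D * (1 / 5) ^ (j - 1 - s)) := by
                gcongr
                · exact hback' s hs'.le
                · exact hM s j hs' hj
            _ = _ := by
                rw [show j - s + 1 = (j - 1 - s) + 2 by omega, pow_add,
                  show (2 / 9 : ℝ) = 10 / 9 * (1 / 5) by norm_num, mul_pow]
                ring
      _ = (100 / 81 * D * ‖f j‖) * ∑ s ∈ Finset.range j, (2 / 9 : ℝ) ^ s := by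
          rw [← Finset.mul_sum, Finset.sum_range_reflect (fun i => (2 / 9 : ℝ) ^ i)]
      _ ≤ (100 / 81 * D * ‖f j‖) * (9 / 7) := by
          gcongr; exact geom_sum_two_ninths_le j
      _ ≤ _ := by nlinarith [mul_nonneg hD0 (norm_nonneg (f j))]
  calc ‖f (j + 1) - (1 + w) * f j‖
      = ‖(∑ s ∈ Finset.range j, f (s - 1) * M s j) + w * (f (j - 1) - f j)‖ := by
        rw [hrec j hj, Finset.sum_range_succ, hMw j hj]
        congr 1; ring
    _ ≤ _ := by
        refine (norm_add_le _ _).trans ?_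
        linarith

/-- A sequence whose successive ratios are within `δ` of `1 + w` is close to `exp (n w)`, with the
Gaussian-type damping factor `exp (-n Q / 5)`. -/
lemma norm_sub_exp_le {δ : ℝ} (hf0 : f 0 = 1)
    (hstep : ∀ j < n, ‖f (j + 1) - (1 + w) * f j‖ ≤ δ * ‖f j‖)
    (hw : ‖w‖ ≤ a) (ha : a ≤ 1 / 72) (hre : w.re = -(Q / 2)) (hQ : Q ≤ 2 * a)
    (hw1 : ‖1 + w‖ ≤ 1 - 49 / 100 * Q) (hδ : δ ≤ 29 / 100 * Q) (hδ0 : 0 ≤ δ) :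
    ‖f n - Complex.exp (n * w)‖ ≤ 2 * n * (δ + a ^ 2) * Real.exp (-(n * Q / 5)) := by
  have ha0 : 0 ≤ a := (norm_nonneg _).trans hw
  have hexp : ∀ j : ℕ, Real.exp (-(((j + 1 : ℕ) : ℝ) * Q / 5)) =
      Real.exp (-(Q / 5)) * Real.exp (-(j * Q / 5)) := fun j => by
    rw [← Real.exp_add]; congr 1; push_cast; ring
  have hdecay : ∀ j ≤ n, ‖f j‖ ≤ Real.exp (-(j * Q / 5)) := by
    intro j
    induction j with
    | zero => simp [hf0]
    | succ j ih =>
      intro hj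
      have h1 : ‖f (j + 1)‖ ≤ (1 - Q / 5) * ‖f j‖ := by
        calc ‖f (j + 1)‖ = ‖(f (j + 1) - (1 + w) * f j) + (1 + w) * f j‖ := by congr 1; ring
          _ ≤ δ * ‖f j‖ + (1 - 49 / 100 * Q) * ‖f j‖ := by
              refine (norm_add_le _ _).trans (add_le_add (hstep j (by omega)) ?_)
              rw [norm_mul]; gcongr
          _ ≤ _ := by nlinarith [norm_nonneg (f j)]
      rw [hexp]
      refine h1.trans ?_
      have h2 : 1 - Q / 5 ≤ Real.exp (-(Q / 5)) := by
        linarith [Real.add_one_le_exp (-(Q / 5))]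
      exact mul_le_mul h2 (ih (by omega)) (norm_nonneg _) (Real.exp_pos _).le
  set ψ := Complex.exp w with hψ
  have hQ0 : 0 ≤ Q := by linarith
  have hψ1 : ‖ψ‖ ≤ Real.exp (-(Q / 5)) := by
    rw [hψ, Complex.norm_exp, hre]
    exact Real.exp_le_exp.2 (by linarith)
  have hψ2 : ‖(1 + w) - ψ‖ ≤ a ^ 2 := by
    have := Complex.norm_exp_sub_one_sub_id_le (x := w) (by linarith)
    rw [norm_sub_rev, ← sub_sub]
    exact this.trans (by gcongr)
  have main : ∀ j ≤ n, ‖f j - ψ ^ j‖ ≤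
      j * (δ + a ^ 2) * Real.exp (Q / 5) * Real.exp (-(j * Q / 5)) := by
    intro j
    induction j with
    | zero => simp [hf0]
    | succ j ih =>
      intro hj
      have h1 : ‖f (j + 1) - ψ * f j‖ ≤ (δ + a ^ 2) * Real.exp (-(j * Q / 5)) := by
        calc ‖f (j + 1) - ψ * f j‖
            = ‖(f (j + 1) - (1 + w) * f j) + ((1 + w) - ψ) * f j‖ := by congr 1; ring
          _ ≤ δ * ‖f j‖ + a ^ 2 * ‖f j‖ := by
              refine (norm_add_le _ _).trans (add_le_add (hstep j (by omega)) ?_)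
              rw [norm_mul]; gcongr
          _ = (δ + a ^ 2) * ‖f j‖ := by ring
          _ ≤ _ := by gcongr; exact hdecay j (by omega)
      calc ‖f (j + 1) - ψ ^ (j + 1)‖
          = ‖(f (j + 1) - ψ * f j) + ψ * (f j - ψ ^ j)‖ := by congr 1; ring
        _ ≤ (δ + a ^ 2) * Real.exp (-(j * Q / 5)) + Real.exp (-(Q / 5)) *
            (j * (δ + a ^ 2) * Real.exp (Q / 5) * Real.exp (-(j * Q / 5))) := by
            refine (norm_add_le _ _).trans (add_le_add h1 ?_)
            rw [norm_mul]
            exact mul_le_mul hψ1 (ih (by omega)) (norm_nonneg _) (Real.exp_pos _).le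
        _ = _ := by
            have : Real.exp (Q / 5) * Real.exp (-(Q / 5)) = 1 := by
              rw [← Real.exp_add]; simp
            rw [hexp]; push_cast
            linear_combination (-(δ + a ^ 2) * Real.exp (-(j * Q / 5))) * this
  have hQexp : Real.exp (Q / 5) ≤ 2 := by
    have h1 := Real.abs_exp_sub_one_le (x := Q / 5) (by rw [abs_of_nonneg (by positivity)]; linarith)
    rw [abs_of_nonneg (by positivity : 0 ≤ Q / 5)] at h1
    have := le_abs_self (Real.exp (Q / 5) - 1)
    linarith
  rw [Complex.exp_nat_mul]
  refine (main n le_rfl).trans ?_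
  calc _ ≤ n * (δ + a ^ 2) * 2 * Real.exp (-(n * Q / 5)) := by gcongr
    _ = _ := by ring

end Recursion

/-! ### Product moments of 1-dependent sequences -/

/-- Expansion of the last factor of `∏ (1 + z i)`, then of the last but one in the term that
contains `z j`, and so on: in the `s`-th term the factor with index `s - 1` is replaced by `1`, so
that for a 1-dependent sequence the two products in it are independent. -/
lemma prod_one_add_succ {R : Type*} [CommRing R] (z : ℕ → R) (j : ℕ) :
    ∏ i ∈ Finset.range (j + 1), (1 + z i) = ∏ i ∈ Finset.range j, (1 + z i) +
      ∑ s ∈ Finset.range (j + 1),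
        (∏ i ∈ Finset.range (s - 1), (1 + z i)) * ∏ i ∈ Finset.Ico s (j + 1), z i := by
  have key : ∀ j, (∏ i ∈ Finset.range j, (1 + z i)) * z j = ∑ s ∈ Finset.range (j + 1),
      (∏ i ∈ Finset.range (s - 1), (1 + z i)) * ∏ i ∈ Finset.Ico s (j + 1), z i := by
    intro j
    induction j with
    | zero => simp
    | succ j ih =>
      rw [Finset.sum_range_succ]
      have h : ∑ s ∈ Finset.range (j + 1),
          (∏ i ∈ Finset.range (s - 1), (1 + z i)) * ∏ i ∈ Finset.Ico s (j + 1 + 1), z i =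
          ((∏ i ∈ Finset.range j, (1 + z i)) * z j) * z (j + 1) := by
        rw [ih, Finset.sum_mul]
        refine Finset.sum_congr rfl fun s hs => ?_
        rw [Finset.prod_Ico_succ_top (by have := Finset.mem_range.1 hs; omega), mul_assoc]
      rw [h, Finset.prod_range_succ, Nat.Ico_succ_singleton, Finset.prod_singleton,
        Nat.add_sub_cancel]
      ring
  rw [Finset.prod_range_succ, mul_add, mul_one, key]

lemma norm_prod_comp_le {k : ℕ} {𝕜 : Type*} [RCLike 𝕜] {C : ℝ} (φ : (Fin k → ℤ) → 𝕜) (hφ : ∀ x, ‖φ x‖ ≤ C) (S : Finset ℕ)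
    (x : ℕ → Fin k → ℤ) :
    ‖∏ i ∈ S, φ (x i)‖ ≤ C ^ S.card := by
  rw [norm_prod]
  exact (Finset.prod_le_prod (fun _ _ => norm_nonneg _) fun i _ => hφ _).trans_eq
    (Finset.prod_const C)

section Model

variable {Ω : Type*} [MeasurableSpace Ω] {k : ℕ} {μ : Measure Ω}
  {X : ℕ → Ω → Fin k → ℤ} {N : ℕ}

section Products

variable {𝕜 : Type*} [RCLike 𝕜]

lemma IsModel.measurable_prod (hX : IsModel μ X N) {S : Finset ℕ} (hS : ∀ i ∈ S, i < N)
    (φ : (Fin k → ℤ) → 𝕜) : Measurable fun ω => ∏ i ∈ S, φ (X i ω) :=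
  Finset.measurable_fun_prod S fun i hi =>
    (Measurable.of_discrete (f := φ)).comp (hX.measurable i (hS i hi))

lemma IsModel.integrable_prod_mul_prod [IsProbabilityMeasure μ] (hX : IsModel μ X N) {S T : Finset ℕ} (hS : ∀ i ∈ S, i < N)
    (hT : ∀ i ∈ T, i < N) {C C' : ℝ} (φ ψ : (Fin k → ℤ) → 𝕜) (hφ : ∀ x, ‖φ x‖ ≤ C)
    (hψ : ∀ x, ‖ψ x‖ ≤ C') :
    Integrable (fun ω => (∏ i ∈ S, φ (X i ω)) * ∏ i ∈ T, ψ (X i ω)) μ := by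
  refine Integrable.of_bound
    ((hX.measurable_prod hS φ).mul (hX.measurable_prod hT ψ)).aestronglyMeasurable
    (C ^ S.card * C' ^ T.card) (.of_forall fun ω => ?_)
  rw [norm_mul]
  exact mul_le_mul (norm_prod_comp_le φ hφ S (X · ω)) (norm_prod_comp_le ψ hψ T (X · ω)) (norm_nonneg _)
    (pow_nonneg ((norm_nonneg _).trans (hφ 0)) _)

lemma IsModel.integrable_prod [IsProbabilityMeasure μ] (hX : IsModel μ X N) {S : Finset ℕ} (hS : ∀ i ∈ S, i < N)
    {C : ℝ} (φ : (Fin k → ℤ) → 𝕜) (hφ : ∀ x, ‖φ x‖ ≤ C) :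
    Integrable (fun ω => ∏ i ∈ S, φ (X i ω)) μ := by
  simpa using hX.integrable_prod_mul_prod hS (T := ∅) (by simp) φ φ hφ hφ

/-- 1-dependence: expectations of products over blocks separated by a gap factor. -/
lemma IsModel.integral_prod_mul_prod [IsProbabilityMeasure μ] (hX : IsModel μ X N) {b : ℕ} {S T : Finset ℕ}
    (hS : ∀ i ∈ S, i + 1 < b) (hT : ∀ i ∈ T, b ≤ i ∧ i < N) (φ ψ : (Fin k → ℤ) → 𝕜) :
    ∫ ω, (∏ i ∈ S, φ (X i ω)) * ∏ i ∈ T, ψ (X i ω) ∂μ =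
      (∫ ω, ∏ i ∈ S, φ (X i ω) ∂μ) * ∫ ω, ∏ i ∈ T, ψ (X i ω) ∂μ := by
  rcases S.eq_empty_or_nonempty with rfl | ⟨s, hs⟩
  · simp
  rcases T.eq_empty_or_nonempty with rfl | ⟨u, hu⟩
  · simp
  have hb : b < N := (hT u hu).1.trans_lt (hT u hu).2
  have hsb := hS s hs
  have hind := hX.oneDependent (b - 2) b (by omega) hb
  have hF : IndepFun (fun ω => ∏ i ∈ S, φ (X i ω)) (fun ω => ∏ i ∈ T, ψ (X i ω)) μ := by
    rw [IndepFun_iff_Indep]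
    refine indep_of_indep_of_le hind (measurable_iff_comap_le.1 ?_) (measurable_iff_comap_le.1 ?_)
    · refine Finset.measurable_fun_prod S fun i hi => (Measurable.of_discrete (f := φ)).comp ?_
      refine measurable_iff_comap_le.2 (le_iSup₂_of_le i ?_ le_rfl)
      have := hS i hi
      simp only [Set.mem_Iic]; omega
    · refine Finset.measurable_fun_prod T fun i hi => (Measurable.of_discrete (f := ψ)).comp ?_
      exact measurable_iff_comap_le.2
        (le_iSup₂_of_le (f := fun i (_ : i ∈ Set.Ico b N) => MeasurableSpace.comap (X i) inferInstance)
          i (hT i hi) le_rfl)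
  refine hF.integral_fun_mul_eq_mul_integral ?_ ?_
  · exact (hX.measurable_prod (fun i hi => by have := hS i hi; omega) φ).aestronglyMeasurable
  · exact (hX.measurable_prod (fun i hi => (hT i hi).2) ψ).aestronglyMeasurable

end Products

section Moments

lemma sum_ite_eq_single {E : Type*} [AddCommMonoid E] (φ : (Fin k → ℤ) → E) (hφ : φ 0 = 0)
    {x : Fin k → ℤ} (hx : x = 0 ∨ ∃ r : Fin k, x = Pi.single r 1) :
    φ x = ∑ r, if x = Pi.single r 1 then φ (Pi.single r 1) else 0 := by
  rcases hx with rfl | ⟨r, rfl⟩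
  · rw [hφ, Finset.sum_eq_zero]
    intro r _
    rw [if_neg]
    intro h
    simpa using congr_fun h r
  · rw [Finset.sum_eq_single r]
    · simp
    · intro j _ hj
      rw [if_neg]
      intro h
      have := congr_fun h j
      simp [Pi.single_eq_of_ne hj] at this
    · simp

lemma IsModel.ae_values (hX : IsModel μ X N) {i : ℕ} (hi : i < N) :
    ∀ᵐ ω ∂μ, X i ω = 0 ∨ ∃ r : Fin k, X i ω = Pi.single r 1 :=
  (hX.identDistrib i hi).symm.ae_snd (p := fun x => x = 0 ∨ ∃ r : Fin k, x = Pi.single r 1)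
    (MeasurableSet.of_discrete) hX.values

lemma IsModel.integral_comp [IsProbabilityMeasure μ] {E : Type*} [NormedAddCommGroup E]
    [NormedSpace ℝ E] [CompleteSpace E]
    (hX : IsModel μ X N) (hN : 0 < N)
    (φ : (Fin k → ℤ) → E) (hφ : φ 0 = 0) :
    ∫ ω, φ (X 0 ω) ∂μ = ∑ r, p1 μ X r • φ (Pi.single r 1) := by
  have hm : ∀ r : Fin k, MeasurableSet {ω | X 0 ω = Pi.single r 1} := fun r =>
    hX.measurable 0 hN (measurableSet_singleton _)
  have : ∀ᵐ ω ∂μ, φ (X 0 ω) =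
      ∑ r, {ω | X 0 ω = Pi.single r 1}.indicator (fun _ => φ (Pi.single r 1)) ω := by
    filter_upwards [hX.values] with ω hω
    simp only [Set.indicator_apply, Set.mem_ofPred_eq]
    exact sum_ite_eq_single φ hφ hω
  rw [integral_congr_ae this, integral_finsetSum]
  · exact Finset.sum_congr rfl fun r _ => integral_indicator_const _ (hm r)
  · exact fun r _ => (integrable_const _).indicator (hm r)

lemma IsModel.integral_comp_mul_comp [IsProbabilityMeasure μ] (hX : IsModel μ X N) (hN : 2 ≤ N)
    (h : (Fin k → ℤ) → ℝ) (h0 : h 0 = 0) :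
    ∫ ω, h (X 0 ω) * h (X 1 ω) ∂μ =
      ∑ r, ∑ j, p2 μ X r j * (h (Pi.single r 1) * h (Pi.single j 1)) := by
  have hm : ∀ r j : Fin k, MeasurableSet {ω | X 0 ω = Pi.single r 1 ∧ X 1 ω = Pi.single j 1} :=
    fun r j => (hX.measurable 0 (by omega) (measurableSet_singleton _)).inter
      (hX.measurable 1 (by omega) (measurableSet_singleton _))
  have : ∀ᵐ ω ∂μ, h (X 0 ω) * h (X 1 ω) =
      ∑ r, ∑ j, {ω | X 0 ω = Pi.single r 1 ∧ X 1 ω = Pi.single j 1}.indicator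
        (fun _ => h (Pi.single r 1) * h (Pi.single j 1)) ω := by
    filter_upwards [hX.values, hX.ae_values (i := 1) (by omega)] with ω h1 h2
    rw [sum_ite_eq_single h h0 h1, sum_ite_eq_single h h0 h2, Finset.sum_mul_sum]
    refine Finset.sum_congr rfl fun r _ => Finset.sum_congr rfl fun j _ => ?_
    simp only [Set.indicator_apply, Set.mem_ofPred_eq, ite_and, ite_mul, mul_ite, zero_mul, mul_zero]
    split_ifs <;> simp
  have hi : ∀ r j : Fin k, Integrable
      ({ω | X 0 ω = Pi.single r 1 ∧ X 1 ω = Pi.single j 1}.indicator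
        fun _ => h (Pi.single r 1) * h (Pi.single j 1)) μ :=
    fun r j => (integrable_const _).indicator (hm r j)
  rw [integral_congr_ae this, integral_finsetSum _ fun r _ => integrable_finsetSum _ fun j _ => hi r j]
  refine Finset.sum_congr rfl fun r _ => ?_
  rw [integral_finsetSum _ fun j _ => hi r j]
  exact Finset.sum_congr rfl fun j _ => integral_indicator_const _ (hm r j)

lemma IsModel.integral_comp_eq {E : Type*} [NormedAddCommGroup E] [NormedSpace ℝ E]
    [MeasurableSpace E] [BorelSpace E] (hX : IsModel μ X N) {i : ℕ} (hi : i < N)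
    (φ : (Fin k → ℤ) → E) : ∫ ω, φ (X i ω) ∂μ = ∫ ω, φ (X 0 ω) ∂μ :=
  ((hX.identDistrib i hi).comp (Measurable.of_discrete (f := φ))).integral_eq

/-- Geometric decay of the product moments of a 1-dependent sequence of small functions: of every
two consecutive factors at the right end of a block, one is bounded by `2` and dropped, which makes
the other independent of the rest of the block. -/
lemma IsModel.integral_prod_Ico_le [IsProbabilityMeasure μ] (hX : IsModel μ X N) (h : (Fin k → ℤ) → ℝ) (h0 : ∀ x, 0 ≤ h x)
    (h2 : ∀ x, h x ≤ 2) {a b : ℝ} (ha : ∫ ω, h (X 0 ω) ∂μ = a)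
    (hb : ∫ ω, h (X 0 ω) * h (X 1 ω) ∂μ = b) (ha' : a ≤ 1 / 72) (s i : ℕ) (hi : s + i + 2 ≤ N) :
    ∫ ω, ∏ l ∈ Finset.Ico s (s + i + 2), h (X l ω) ∂μ ≤ (b + 10 * a ^ 2) * (1 / 5) ^ i := by
  have hnorm : ∀ x, ‖h x‖ ≤ 2 := fun x => by rw [Real.norm_of_nonneg (h0 x)]; exact h2 x
  have ha0 : 0 ≤ a := ha ▸ integral_nonneg fun ω => h0 _
  have hb0 : 0 ≤ b := hb ▸ integral_nonneg fun ω => mul_nonneg (h0 _) (h0 _)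
  have hdrop : ∀ e, s < e → e + 2 ≤ N → ∫ ω, ∏ l ∈ Finset.Ico s (e + 2), h (X l ω) ∂μ ≤
      2 * a * ∫ ω, ∏ l ∈ Finset.Ico s e, h (X l ω) ∂μ := by
    intro e hse heN
    have hS : ∀ l ∈ Finset.Ico s e, l < N := fun l hl => by
      have := (Finset.mem_Ico.1 hl).2; omega
    have hT : ∀ l ∈ ({e + 1} : Finset ℕ), l < N := fun l hl => by
      have := Finset.mem_singleton.1 hl; omega
    calc _ ≤ ∫ ω, 2 * ((∏ l ∈ Finset.Ico s e, h (X l ω)) * ∏ l ∈ {e + 1}, h (X l ω)) ∂μ := by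
          refine integral_mono (hX.integrable_prod (fun l hl => ?_) h hnorm)
            ((hX.integrable_prod_mul_prod hS hT h h hnorm hnorm).const_mul 2) fun ω => ?_
          · have := (Finset.mem_Ico.1 hl).2; omega
          · simp only [Finset.prod_singleton]
            rw [Finset.prod_Ico_succ_top (by omega), Finset.prod_Ico_succ_top (by omega)]
            have hP : 0 ≤ ∏ l ∈ Finset.Ico s e, h (X l ω) := Finset.prod_nonneg fun l _ => h0 _
            calc _ = (∏ l ∈ Finset.Ico s e, h (X l ω)) * h (X (e + 1) ω) * h (X e ω) := by ring
              _ ≤ (∏ l ∈ Finset.Ico s e, h (X l ω)) * h (X (e + 1) ω) * 2 := by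
                  gcongr
                  · exact mul_nonneg hP (h0 _)
                  · exact h2 _
              _ = _ := by ring
      _ = _ := by
          rw [integral_const_mul, hX.integral_prod_mul_prod (b := e + 1)
            (fun l hl => by have := (Finset.mem_Ico.1 hl).2; omega)
            (fun l hl => by have := Finset.mem_singleton.1 hl; omega)]
          simp only [Finset.prod_singleton]
          rw [hX.integral_comp_eq (i := e + 1) (by omega) h, ha]
          ring
  induction i using Nat.twoStepInduction with
  | zero =>
    have hpair := ((hX.identDistrib_pair s (by omega)).comp
      (u := fun p : (Fin k → ℤ) × (Fin k → ℤ) => h p.1 * h p.2) Measurable.of_discrete).integral_eq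
    simp only [Function.comp_def] at hpair
    rw [hb] at hpair
    simp_rw [show s + 0 + 2 = s + 1 + 1 from rfl, Finset.prod_Ico_succ_top (show s ≤ s + 1 by omega),
      Nat.Ico_succ_singleton, Finset.prod_singleton]
    rw [hpair]
    nlinarith [sq_nonneg a]
  | one =>
    refine (hdrop (s + 1) (by omega) (by omega)).trans ?_
    simp_rw [Nat.Ico_succ_singleton, Finset.prod_singleton]
    rw [hX.integral_comp_eq (i := s) (by omega) h, ha]
    nlinarith
  | more i ih _ =>
    refine (hdrop (s + i + 2) (by omega) (by omega)).trans ?_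
    have h1 := ih (by omega)
    have h3 : 0 ≤ (b + 10 * a ^ 2) * (1 / 5) ^ i := by positivity
    calc 2 * a * _ ≤ 2 * a * ((b + 10 * a ^ 2) * (1 / 5) ^ i) := by gcongr
      _ ≤ (1 / 25) * ((b + 10 * a ^ 2) * (1 / 5) ^ i) := by gcongr; linarith
      _ = _ := by rw [pow_add]; ring

end Moments

end Model

/-! ### The characteristic function of the sum -/

section Estimates

variable {Ω : Type*} [MeasurableSpace Ω] {k : ℕ} {μ : Measure Ω} {X : ℕ → Ω → Fin k → ℤ} {n : ℕ}

lemma p1_nonneg (r : Fin k) : 0 ≤ p1 μ X r := measureReal_nonneg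

lemma p2_nonneg (r j : Fin k) : 0 ≤ p2 μ X r j := measureReal_nonneg

lemma gam_pos (j : Fin k) : 0 < gam μ X n j := zero_lt_one.trans_le (le_max_left _ _)

lemma eps1_nonneg : 0 ≤ eps1 μ X n :=
  Finset.sum_nonneg fun r _ => Finset.sum_nonneg fun j _ => div_nonneg
    (add_nonneg (p2_nonneg r j) (mul_nonneg (p1_nonneg r) (p1_nonneg j)))
    (mul_pos (gam_pos r) (gam_pos j)).le

lemma norm_chi_sub_one_le (m : Fin k → ℤ) (t : Fin k → ℝ) : ‖chi m t - 1‖ ≤ 2 := by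
  refine (norm_sub_le _ _).trans ?_
  rw [norm_chi, norm_one]; norm_num

/-- Points `1 + z` of the unit circle satisfy `Re z = -|z|² / 2`. -/
lemma re_eq_of_norm_one_add_eq_one {z : ℂ} (hz : ‖1 + z‖ = 1) : z.re = -(‖z‖ ^ 2 / 2) := by
  have h1 : ‖1 + z‖ ^ 2 = 1 := by rw [hz]; norm_num
  rw [← Complex.normSq_eq_norm_sq, Complex.normSq_apply] at h1
  rw [← Complex.normSq_eq_norm_sq, Complex.normSq_apply]
  simp only [Complex.add_re, Complex.add_im, Complex.one_re, Complex.one_im] at h1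
  linarith

lemma sum_p1_le (hk : 1 ≤ k) (hS : SmallnessCond μ X) : ∑ r, p1 μ X r ≤ 1 / 144 := by
  refine (Finset.sum_le_sum fun r _ => hS.1 r).trans ?_
  have : (k : ℝ) ≠ 0 := by positivity
  rw [Finset.sum_const, Finset.card_univ, Fintype.card_fin, nsmul_eq_mul]
  apply le_of_eq
  field_simp

lemma sum_p2_mul_le (hS : SmallnessCond μ X) (x : Fin k → ℝ) :
    ∑ r, ∑ j, p2 μ X r j * (x r * x j) ≤ (∑ j, p1 μ X j * x j ^ 2) / 10 := by
  calc ∑ r, ∑ j, p2 μ X r j * (x r * x j)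
      ≤ ∑ r, ∑ j, (p2 μ X r j * (x r ^ 2 / 2) + p2 μ X r j * (x j ^ 2 / 2)) :=
        Finset.sum_le_sum fun r _ => Finset.sum_le_sum fun j _ => by
          nlinarith [mul_nonneg (p2_nonneg (μ := μ) (X := X) r j) (sq_nonneg (x r - x j))]
    _ = ∑ j, (∑ m, (p2 μ X m j + p2 μ X j m)) * (x j ^ 2 / 2) := by
        simp_rw [Finset.sum_add_distrib]
        rw [add_comm, Finset.sum_comm, ← Finset.sum_add_distrib]
        refine Finset.sum_congr rfl fun j _ => ?_
        rw [add_mul, Finset.sum_mul, Finset.sum_mul]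
    _ ≤ ∑ j, p1 μ X j / 5 * (x j ^ 2 / 2) :=
        Finset.sum_le_sum fun j _ => mul_le_mul_of_nonneg_right (hS.2 j) (by positivity)
    _ = _ := by
        rw [Finset.sum_div]
        exact Finset.sum_congr rfl fun j _ => by ring

lemma sq_sum_p1_mul_le (hk : 1 ≤ k) (hS : SmallnessCond μ X) (x : Fin k → ℝ) :
    (∑ j, p1 μ X j * x j) ^ 2 ≤ (∑ j, p1 μ X j * x j ^ 2) / 144 := by
  have h := Finset.sum_sq_le_sum_mul_sum_of_sq_le_mul Finset.univ (r := fun j => p1 μ X j * x j)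
    (f := fun j => p1 μ X j) (g := fun j => p1 μ X j * x j ^ 2) (fun j _ => p1_nonneg j)
    (fun j _ => mul_nonneg (p1_nonneg j) (sq_nonneg _)) (fun j _ => (by ring : _ = _).le)
  have h2 : 0 ≤ ∑ j, p1 μ X j * x j ^ 2 :=
    Finset.sum_nonneg fun j _ => mul_nonneg (p1_nonneg j) (sq_nonneg _)
  nlinarith [sum_p1_le hk hS]

variable [IsProbabilityMeasure μ]

set_option maxHeartbeats 1000000 in
/-- The characteristic functions of `X_1 + ⋯ + X_n` and of the Poisson law are close, with a Gaussian-type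
damping factor. -/
lemma IsModel.norm_ft_sub_le (hk : 1 ≤ k) (hX : IsModel μ X (max n 2))
    (hS : SmallnessCond μ X) (t : Fin k → ℝ) :
    ‖ft (sumLaw μ X n) t - ft (pois fun j => (n * p1 μ X j).toNNReal) t‖ ≤
      40 * n * (∑ r, ∑ j, (p2 μ X r j + p1 μ X r * p1 μ X j) *
        (‖chi (Pi.single r 1) t - 1‖ * ‖chi (Pi.single j 1) t - 1‖)) *
      Real.exp (-(n * (∑ r, p1 μ X r * ‖chi (Pi.single r 1) t - 1‖ ^ 2) / 5)) := by
  set z : Fin k → ℂ := fun r => chi (Pi.single r 1) t - 1 with hz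
  set g : (Fin k → ℤ) → ℂ := fun x => chi x t - 1 with hg
  set h : (Fin k → ℤ) → ℝ := fun x => ‖g x‖ with hh
  set a : ℝ := ∑ r, p1 μ X r * ‖z r‖ with ha
  set b : ℝ := ∑ r, ∑ j, p2 μ X r j * (‖z r‖ * ‖z j‖) with hb
  set Q : ℝ := ∑ r, p1 μ X r * ‖z r‖ ^ 2 with hQ
  set w : ℂ := ∑ r, p1 μ X r • z r with hw
  set f : ℕ → ℂ := fun j => ∫ ω, ∏ i ∈ Finset.range j, chi (X i ω) t ∂μ with hf
  set M : ℕ → ℕ → ℂ := fun s j => ∫ ω, ∏ i ∈ Finset.Ico s (j + 1), g (X i ω) ∂μ with hM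
  have hz2 : ∀ r, ‖z r‖ ≤ 2 := fun r => norm_chi_sub_one_le _ _
  have hg2 : ∀ x, ‖g x‖ ≤ 2 := fun x => norm_chi_sub_one_le _ _
  have hg0 : g 0 = 0 := by simp [hg, chi_zero]
  have hh0 : h 0 = 0 := by simp [hh, hg0]
  have hN2 : 2 ≤ max n 2 := le_max_right _ _
  have hNn : n ≤ max n 2 := le_max_left _ _
  have hEa : ∫ ω, h (X 0 ω) ∂μ = a := by
    rw [hX.integral_comp (by omega) h hh0]; rfl
  have hEb : ∫ ω, h (X 0 ω) * h (X 1 ω) ∂μ = b := hX.integral_comp_mul_comp hN2 h hh0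
  have hEw : ∫ ω, g (X 0 ω) ∂μ = w := hX.integral_comp (by omega) g hg0
  -- numerical consequences of the smallness conditions
  have ha0 : 0 ≤ a := Finset.sum_nonneg fun r _ => mul_nonneg (p1_nonneg r) (norm_nonneg _)
  have hb0 : 0 ≤ b := Finset.sum_nonneg fun r _ => Finset.sum_nonneg fun j _ =>
    mul_nonneg (p2_nonneg r j) (by positivity)
  have ha1 : a ≤ 1 / 72 := by
    calc a ≤ ∑ r, p1 μ X r * 2 :=
          Finset.sum_le_sum fun r _ => mul_le_mul_of_nonneg_left (hz2 r) (p1_nonneg r)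
      _ ≤ _ := by rw [← Finset.sum_mul]; linarith [sum_p1_le hk hS]
  have hQa : Q ≤ 2 * a := by
    rw [ha, Finset.mul_sum]
    refine Finset.sum_le_sum fun r _ => ?_
    nlinarith [mul_nonneg (mul_nonneg (p1_nonneg (μ := μ) (X := X) r) (norm_nonneg (z r)))
      (sub_nonneg.2 (hz2 r))]
  have hQ0 : 0 ≤ Q := Finset.sum_nonneg fun r _ => mul_nonneg (p1_nonneg r) (sq_nonneg _)
  have hbQ : b ≤ Q / 10 := sum_p2_mul_le hS fun r => ‖z r‖
  have haQ : a ^ 2 ≤ Q / 144 := sq_sum_p1_mul_le hk hS fun r => ‖z r‖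
  have hwa : ‖w‖ ≤ a := by
    refine (norm_sum_le _ _).trans (Finset.sum_le_sum fun r _ => ?_)
    rw [norm_smul, Real.norm_of_nonneg (p1_nonneg r)]
  have hre : w.re = -(Q / 2) := by
    rw [hw, Complex.re_sum, hQ, Finset.sum_div, ← Finset.sum_neg_distrib]
    refine Finset.sum_congr rfl fun r _ => ?_
    rw [Complex.smul_re, re_eq_of_norm_one_add_eq_one (z := z r) (by simp [hz, norm_chi]), smul_eq_mul]
    ring
  have hw1 : ‖1 + w‖ ≤ 1 - 49 / 100 * Q := by
    refine le_of_sq_le_sq ?_ (by linarith)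
    have h1 : ‖1 + w‖ ^ 2 = 1 + 2 * w.re + ‖w‖ ^ 2 := by
      rw [← Complex.normSq_eq_norm_sq, ← Complex.normSq_eq_norm_sq, Complex.normSq_apply,
        Complex.normSq_apply]
      simp only [Complex.add_re, Complex.add_im, Complex.one_re, Complex.one_im]
      ring
    have h2 : ‖w‖ ^ 2 ≤ a ^ 2 := by gcongr
    rw [h1, hre]
    nlinarith [sq_nonneg Q]
  -- the recursion for the characteristic functions of the partial sums
  have hrec : ∀ j < n, f (j + 1) = f j + ∑ s ∈ Finset.range (j + 1), f (s - 1) * M s j := by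
    intro j hj
    have hexp : ∀ ω, ∏ i ∈ Finset.range (j + 1), chi (X i ω) t =
        ∏ i ∈ Finset.range j, chi (X i ω) t + ∑ s ∈ Finset.range (j + 1),
          (∏ i ∈ Finset.range (s - 1), chi (X i ω) t) * ∏ i ∈ Finset.Ico s (j + 1), g (X i ω) := by
      intro ω
      have := prod_one_add_succ (fun i => g (X i ω)) j
      simpa only [hg, add_sub_cancel] using this
    have hlt : ∀ s ∈ Finset.range (j + 1), ∀ i ∈ Finset.range (s - 1), i < max n 2 :=
      fun s hs i hi => by
        have := Finset.mem_range.1 hs; have := Finset.mem_range.1 hi; omega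
    have hlt' : ∀ s, ∀ i ∈ Finset.Ico s (j + 1), i < max n 2 := fun s i hi => by
      have := (Finset.mem_Ico.1 hi).2; omega
    simp only [hf]
    simp_rw [hexp]
    rw [integral_add, integral_finsetSum]
    · congr 1
      refine Finset.sum_congr rfl fun s _ => ?_
      refine hX.integral_prod_mul_prod (b := s) (fun i hi => ?_) (fun i hi => ?_)
        (fun x => chi x t) g
      · have := Finset.mem_range.1 hi; omega
      · exact ⟨(Finset.mem_Ico.1 hi).1, hlt' s i hi⟩
    · exact fun s hs => hX.integrable_prod_mul_prod (hlt s hs) (hlt' s) (fun x => chi x t) g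
        (fun x => (norm_chi x t).le) hg2
    · exact hX.integrable_prod (fun i hi => by have := Finset.mem_range.1 hi; omega)
        (fun x => chi x t) (fun x => (norm_chi x t).le)
    · exact integrable_finsetSum _ fun s hs => hX.integrable_prod_mul_prod (hlt s hs) (hlt' s)
        (fun x => chi x t) g (fun x => (norm_chi x t).le) hg2
  have hMw : ∀ j < n, M j j = w := fun j hj => by
    simp only [hM, Nat.Ico_succ_singleton, Finset.prod_singleton]
    rw [hX.integral_comp_eq (by omega) g, hEw]
  have hMb : ∀ s j, s < j → j < n → ‖M s j‖ ≤ (b + 10 * a ^ 2) * (1 / 5) ^ (j - 1 - s) := by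
    intro s j hsj hj
    refine (norm_integral_le_integral_norm _).trans ?_
    simp_rw [norm_prod]
    have := hX.integral_prod_Ico_le h (fun x => norm_nonneg _) hg2 hEa hEb ha1 s (j - 1 - s)
      (by omega)
    rwa [show s + (j - 1 - s) + 2 = j + 1 by omega] at this
  have hstep := norm_sub_one_add_mul_le hrec hMw hwa hMb ha1 (by linarith) (by positivity)
  have hf0 : f 0 = 1 := by simp [hf]
  -- with `b ≤ Q / 10` and `a² ≤ Q / 144`, the error of a ratio is at most `0.285 Q`
  have hfinal := norm_sub_exp_le hf0 hstep hwa ha1 hre hQa hw1 (by linarith) (by positivity)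
  have hft : ft (sumLaw μ X n) t = f n := by
    have hmeas : Measurable fun ω => ∑ i ∈ Finset.range n, X i ω :=
      Finset.measurable_fun_sum _ fun i hi => hX.measurable i
        (by have := Finset.mem_range.1 hi; omega)
    rw [ft, sumLaw, integral_map hmeas.aemeasurable
      (Measurable.of_discrete (f := fun m => chi m t)).aestronglyMeasurable]
    simp_rw [chi_sum]
    rfl
  have hpois : ft (pois fun j => (n * p1 μ X j).toNNReal) t = Complex.exp (n * w) := by
    rw [ft_pois, hw, Finset.mul_sum]
    congr 1
    refine Finset.sum_congr rfl fun j _ => ?_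
    rw [Complex.real_smul, ← mul_assoc]
    congr 1
    have : (((n * p1 μ X j).toNNReal : ℝ) : ℂ) = ((n * p1 μ X j : ℝ) : ℂ) := by
      rw [Real.coe_toNNReal _ (mul_nonneg n.cast_nonneg (p1_nonneg j))]
    simpa using this
  have hab : ∑ r, ∑ j, (p2 μ X r j + p1 μ X r * p1 μ X j) * (‖z r‖ * ‖z j‖) = b + a ^ 2 := by
    rw [pow_two, ha, hb, Finset.sum_mul_sum, ← Finset.sum_add_distrib]
    refine Finset.sum_congr rfl fun r _ => ?_
    rw [← Finset.sum_add_distrib]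
    exact Finset.sum_congr rfl fun j _ => by ring
  rw [hft, hpois]
  change _ ≤ 40 * n * (∑ r, ∑ j, (p2 μ X r j + p1 μ X r * p1 μ X j) * (‖z r‖ * ‖z j‖)) * _
  rw [hab]
  refine hfinal.trans (mul_le_mul_of_nonneg_right ?_ (Real.exp_pos _).le)
  have : 8 / 5 * (b + 10 * a ^ 2) + 2 * a ^ 2 + a ^ 2 ≤ 20 * (b + a ^ 2) := by
    nlinarith [sq_nonneg a]
  calc _ ≤ 2 * n * (20 * (b + a ^ 2)) := by gcongr
    _ = _ := by ring

/-- A factor `|z_r|` costs a part of the damping and gains `1 / γ_r`. -/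
lemma mul_exp_neg_le_div {x p q : ℝ} (hx : x ≤ 2) (hp : 0 ≤ p) (hq : p * x ^ 2 ≤ q) :
    x * Real.exp (-(q / 20)) ≤ 5 / max 1 (Real.sqrt p) := by
  rw [le_div_iff₀ (zero_lt_one.trans_le (le_max_left _ _))]
  have hq0 : 0 ≤ q := (by positivity : 0 ≤ p * x ^ 2).trans hq
  have key : x * max 1 (Real.sqrt p) ≤ 5 * Real.exp (q / 20) := by
    have h1 := Real.add_one_le_exp (q / 20)
    rcases le_total (Real.sqrt p) 1 with h | h
    · rw [max_eq_left h]; linarith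
    · rw [max_eq_right h]
      have h2 : (x * Real.sqrt p) ^ 2 ≤ q := by rw [mul_pow, Real.sq_sqrt hp]; linarith
      nlinarith [sq_nonneg (x * Real.sqrt p - 2)]
  calc _ = x * max 1 (Real.sqrt p) * Real.exp (-(q / 20)) := by ring
    _ ≤ 5 * Real.exp (q / 20) * Real.exp (-(q / 20)) := by gcongr
    _ = 5 := by rw [mul_assoc, ← Real.exp_add]; simp

lemma IsModel.norm_ft_sub_le_eps1 (hk : 1 ≤ k) (hX : IsModel μ X (max n 2))
    (hS : SmallnessCond μ X) (t : Fin k → ℝ) :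
    ‖ft (sumLaw μ X n) t - ft (pois fun j => (n * p1 μ X j).toNNReal) t‖ ≤
      1000 * n * eps1 μ X n *
      Real.exp (-(1 / 10 * ∑ r, n * p1 μ X r * ‖chi (Pi.single r 1) t - 1‖ ^ 2)) := by
  refine (hX.norm_ft_sub_le hk hS t).trans ?_
  set x : Fin k → ℝ := fun r => ‖chi (Pi.single r 1) t - 1‖ with hx
  set q : ℝ := ∑ r, n * p1 μ X r * x r ^ 2 with hq
  have hqe : n * (∑ r, p1 μ X r * x r ^ 2) = q := by
    rw [hq, Finset.mul_sum]
    exact Finset.sum_congr rfl fun r _ => by ring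
  have hdamp : ∀ r, x r * Real.exp (-(q / 20)) ≤ 5 / gam μ X n r := fun r =>
    mul_exp_neg_le_div (norm_chi_sub_one_le _ _)
      (mul_nonneg n.cast_nonneg (p1_nonneg r))
      (Finset.single_le_sum (f := fun r => n * p1 μ X r * x r ^ 2) (fun r _ =>
        mul_nonneg (mul_nonneg n.cast_nonneg (p1_nonneg r)) (sq_nonneg _)) (Finset.mem_univ r))
  have hsplit : Real.exp (-(q / 5)) =
      Real.exp (-(q / 20)) * Real.exp (-(q / 20)) * Real.exp (-(1 / 10 * q)) := by
    rw [← Real.exp_add, ← Real.exp_add]; congr 1; ring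
  change 40 * n * (∑ r, ∑ j, (p2 μ X r j + p1 μ X r * p1 μ X j) * (x r * x j)) *
    Real.exp (-(n * (∑ r, p1 μ X r * x r ^ 2) / 5)) ≤ _
  rw [hqe, hsplit]
  have hsum : (∑ r, ∑ j, (p2 μ X r j + p1 μ X r * p1 μ X j) * (x r * x j)) *
      (Real.exp (-(q / 20)) * Real.exp (-(q / 20))) ≤ 25 * eps1 μ X n := by
    rw [eps1, Finset.sum_mul, Finset.mul_sum]
    refine Finset.sum_le_sum fun r _ => ?_
    rw [Finset.sum_mul, Finset.mul_sum]
    refine Finset.sum_le_sum fun j _ => ?_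
    have hc : 0 ≤ p2 μ X r j + p1 μ X r * p1 μ X j :=
      add_nonneg (p2_nonneg r j) (mul_nonneg (p1_nonneg r) (p1_nonneg j))
    calc _ = (p2 μ X r j + p1 μ X r * p1 μ X j) *
          ((x r * Real.exp (-(q / 20))) * (x j * Real.exp (-(q / 20)))) := by ring
      _ ≤ (p2 μ X r j + p1 μ X r * p1 μ X j) * ((5 / gam μ X n r) * (5 / gam μ X n j)) := by
          refine mul_le_mul_of_nonneg_left (mul_le_mul (hdamp r) (hdamp j) ?_ ?_) hc
          · exact mul_nonneg (norm_nonneg _) (Real.exp_pos _).le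
          · exact (div_pos (by norm_num) (gam_pos r)).le
      _ = _ := by rw [div_mul_div_comm]; ring
  calc _ = 40 * n * ((∑ r, ∑ j, (p2 μ X r j + p1 μ X r * p1 μ X j) * (x r * x j)) *
        (Real.exp (-(q / 20)) * Real.exp (-(q / 20)))) * Real.exp (-(1 / 10 * q)) := by ring
    _ ≤ 40 * n * (25 * eps1 μ X n) * Real.exp (-(1 / 10 * q)) := by gcongr
    _ = _ := by ring

end Estimates

/-! ### Norms of the approximation error -/

section Norms

variable {k : ℕ}

/-- Interpolation of the `ℓ_α` norm, `α ≥ 2`, between the local norm and the `ℓ_2` norm. -/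
lemma lNorm_le_of_abs_le_of_hasSum_sq {α : ℝ} (hα : 2 ≤ α) {M : SignedMeasure (Fin k → ℤ)}
    {K P S : ℝ} (hK : 0 ≤ K) (hP : 0 < P) (hsup : ∀ m, |M {m}| ≤ K * P)
    (hsum : HasSum (fun m => M {m} ^ 2) S) (hS : S ≤ K ^ 2 * P) :
    lNorm α M ≤ ENNReal.ofReal (K * P ^ ((α - 1) / α)) := by
  have hα0 : 0 < α := by linarith
  have hKP : 0 ≤ K * P := by positivity
  have hsq : ∑' m, ‖M {m}‖ₑ ^ (2 : ℝ) ≤ ENNReal.ofReal (K ^ 2 * P) := by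
    refine le_trans (le_of_eq ?_) (ENNReal.ofReal_le_ofReal hS)
    rw [← hsum.tsum_eq, ENNReal.ofReal_tsum_of_nonneg (fun m => sq_nonneg _) hsum.summable]
    refine tsum_congr fun m => ?_
    rw [Real.enorm_eq_ofReal_abs, ENNReal.ofReal_rpow_of_nonneg (abs_nonneg _) (by norm_num),
      Real.rpow_two, sq_abs]
  have hpow : (K * P) ^ (α - 2) * (K ^ 2 * P) = K ^ α * P ^ (α - 1) := by
    rw [Real.mul_rpow hK hP.le]
    have h1 : K ^ α = K ^ (α - 2) * K ^ 2 := by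
      rw [← Real.rpow_two, ← Real.rpow_add_of_nonneg hK (by linarith) (by norm_num)]
      congr 1; ring
    have h2 : P ^ (α - 1) = P ^ (α - 2) * P := by
      rw [← Real.rpow_add_one hP.ne']; congr 1; ring
    rw [h1, h2]; ring
  have hmain : ∑' m, ‖M {m}‖ₑ ^ α ≤ ENNReal.ofReal (K ^ α * P ^ (α - 1)) := by
    calc ∑' m, ‖M {m}‖ₑ ^ α
        ≤ ∑' m, ENNReal.ofReal ((K * P) ^ (α - 2)) * ‖M {m}‖ₑ ^ (2 : ℝ) := by
          refine ENNReal.tsum_le_tsum fun m => ?_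
          rw [← ENNReal.ofReal_rpow_of_nonneg hKP (by linarith)]
          calc ‖M {m}‖ₑ ^ α = ‖M {m}‖ₑ ^ (α - 2) * ‖M {m}‖ₑ ^ (2 : ℝ) := by
                rw [← ENNReal.rpow_add_of_nonneg _ _ (by linarith) (by norm_num)]
                congr 1; ring
            _ ≤ _ := by
                refine mul_le_mul_left (ENNReal.rpow_le_rpow ?_ (by linarith)) _
                rw [Real.enorm_eq_ofReal_abs]
                exact ENNReal.ofReal_le_ofReal (hsup m)
      _ ≤ ENNReal.ofReal ((K * P) ^ (α - 2)) * ENNReal.ofReal (K ^ 2 * P) := by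
          rw [ENNReal.tsum_mul_left]; gcongr
      _ = _ := by rw [← ENNReal.ofReal_mul (by positivity), hpow]
  calc lNorm α M ≤ ENNReal.ofReal (K ^ α * P ^ (α - 1)) ^ (1 / α) := by
        unfold lNorm; gcongr
    _ = _ := by
        rw [ENNReal.ofReal_rpow_of_nonneg (by positivity) (by positivity),
          Real.mul_rpow (by positivity) (by positivity), ← Real.rpow_mul hK, ← Real.rpow_mul hP.le,
          mul_one_div_cancel hα0.ne', Real.rpow_one, mul_one_div]

end Norms

section PoissonError

variable {Ω : Type*} [MeasurableSpace Ω] {k : ℕ} {μ : Measure Ω} [IsProbabilityMeasure μ]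
  {X : ℕ → Ω → Fin k → ℤ} {n : ℕ}

lemma poissonError_singleton (m : Fin k → ℤ) :
    poissonError μ X n {m} =
      (sumLaw μ X n).real {m} - (pois fun j => (n * p1 μ X j).toNNReal).real {m} := by
  rw [poissonError, sub_apply,
    Measure.toSignedMeasure_apply_measurable (measurableSet_singleton m),
    Measure.toSignedMeasure_apply_measurable (measurableSet_singleton m)]

lemma IsModel.isProbabilityMeasure_sumLaw (hX : IsModel μ X (max n 2)) :
    IsProbabilityMeasure (sumLaw μ X n) :=
  Measure.isProbabilityMeasure_map (Finset.measurable_fun_sum _ fun i hi => hX.measurable i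
    ((Finset.mem_range.1 hi).trans_le (le_max_left _ _))).aemeasurable

/-- Pointwise and `ℓ_2` bounds for the error of the Poisson approximation. -/
lemma IsModel.poissonError_bounds (hk : 1 ≤ k) (hX : IsModel μ X (max n 2))
    (hS : SmallnessCond μ X) :
    (∀ m, |poissonError μ X n {m}| ≤
      1000 * 2 ^ k * n * eps1 μ X n * ∏ j, (gam μ X n j)⁻¹) ∧
    ∃ S, HasSum (fun m => poissonError μ X n {m} ^ 2) S ∧
      S ≤ (1000 * 2 ^ k * n * eps1 μ X n) ^ 2 * ∏ j, (gam μ X n j)⁻¹ := by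
  have := hX.isProbabilityMeasure_sumLaw
  set ν := sumLaw μ X n
  set ν' := pois fun j => (n * p1 μ X j).toNNReal
  set K : ℝ := 1000 * n * eps1 μ X n with hK
  have hK0 : 0 ≤ K := mul_nonneg (by positivity) eps1_nonneg
  set G : (Fin k → ℝ) → ℝ := fun t =>
    Real.exp (-(1 / 10 * ∑ r, n * p1 μ X r * ‖chi (Pi.single r 1) t - 1‖ ^ 2)) with hG
  have hG0 : ∀ t, 0 < G t := fun t => Real.exp_pos _
  have hG1 : ∀ t, G t ≤ 1 := fun t => Real.exp_le_one_iff.2 <| neg_nonpos.2 <|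
    mul_nonneg (by norm_num) <| Finset.sum_nonneg fun r _ =>
      mul_nonneg (mul_nonneg n.cast_nonneg (p1_nonneg r)) (sq_nonneg _)
  have hGi : Integrable G (cube k) := by
    refine Integrable.of_bound (Continuous.aestronglyMeasurable (by fun_prop)) 1
      (.of_forall fun t => ?_)
    rw [Real.norm_of_nonneg (hG0 t).le]; exact hG1 t
  have hGint : ∫ t, G t ∂cube k ≤ 2 ^ k * ∏ j, (gam μ X n j)⁻¹ :=
    integral_exp_neg_sum_le (fun j => n * p1 μ X j) fun j =>
      mul_nonneg n.cast_nonneg (p1_nonneg j)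
  have hb : ∀ t, ‖ft ν t - ft ν' t‖ ≤ K * G t := hX.norm_ft_sub_le_eps1 hk hS
  refine ⟨fun m => ?_, ∫ t, ‖ft ν t - ft ν' t‖ ^ 2 ∂cube k, ?_, ?_⟩
  · rw [poissonError_singleton]
    calc _ ≤ ∫ t, ‖ft ν t - ft ν' t‖ ∂cube k := abs_sub_le_integral_norm_ft ν ν' m
      _ ≤ ∫ t, K * G t ∂cube k :=
          integral_mono_of_nonneg (.of_forall fun t => norm_nonneg _) (hGi.const_mul K)
            (.of_forall hb)
      _ ≤ K * (2 ^ k * ∏ j, (gam μ X n j)⁻¹) := by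
          rw [integral_const_mul]; gcongr
      _ = _ := by rw [hK]; ring
  · simp_rw [poissonError_singleton]
    exact hasSum_sq_sub ν ν'
  · calc _ ≤ ∫ t, K ^ 2 * G t ∂cube k := by
          refine integral_mono_of_nonneg (.of_forall fun t => sq_nonneg _) (hGi.const_mul _)
            (.of_forall fun t => ?_)
          calc ‖ft ν t - ft ν' t‖ ^ 2 ≤ (K * G t) ^ 2 := by gcongr; exact hb t
            _ = K ^ 2 * (G t * G t) := by ring
            _ ≤ K ^ 2 * (G t * 1) := by
                exact mul_le_mul_of_nonneg_left
                  (mul_le_mul_of_nonneg_left (hG1 t) (hG0 t).le) (sq_nonneg K)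
            _ = _ := by rw [mul_one]
      _ ≤ K ^ 2 * (2 ^ k * ∏ j, (gam μ X n j)⁻¹) := by
          rw [integral_const_mul]; gcongr
      _ ≤ K ^ 2 * ((2 ^ k) ^ 2 * ∏ j, (gam μ X n j)⁻¹) := by
          have h2 : (2 : ℝ) ^ k ≤ (2 ^ k) ^ 2 :=
            le_self_pow₀ (one_le_pow₀ (by norm_num)) (by norm_num)
          have hP : 0 ≤ ∏ j, (gam μ X n j)⁻¹ :=
            Finset.prod_nonneg fun j _ => inv_nonneg.2 (gam_pos j).le
          gcongr
      _ = _ := by rw [hK]; ring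

end PoissonError

end MultiPoisson

theorem theorem1 (k : ℕ) (hk : 1 ≤ k) :
    (∃ C : ℝ, 0 < C ∧
      ∀ {Ω : Type*} [MeasurableSpace Ω] (μ : Measure Ω) [IsProbabilityMeasure μ]
        (n : ℕ) (X : ℕ → Ω → Fin k → ℤ), 1 ≤ n →
        MultiPoisson.IsModel μ X (max n 2) → MultiPoisson.SmallnessCond μ X →
        MultiPoisson.localNorm (MultiPoisson.poissonError μ X n) ≤
          ENNReal.ofReal (C * n * MultiPoisson.eps1 μ X n *
            ∏ j, (MultiPoisson.gam μ X n j)⁻¹)) ∧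
    (∀ α : ℝ, 2 ≤ α → ∃ C : ℝ, 0 < C ∧
      ∀ {Ω : Type*} [MeasurableSpace Ω] (μ : Measure Ω) [IsProbabilityMeasure μ]
        (n : ℕ) (X : ℕ → Ω → Fin k → ℤ), 1 ≤ n →
        MultiPoisson.IsModel μ X (max n 2) → MultiPoisson.SmallnessCond μ X →
        MultiPoisson.lNorm α (MultiPoisson.poissonError μ X n) ≤
          ENNReal.ofReal (C * n * MultiPoisson.eps1 μ X n *
            ∏ j, MultiPoisson.gam μ X n j ^ (-((α - 1) / α)))) := by
  refine ⟨⟨1000 * 2 ^ k, by positivity, ?_⟩, fun α hα => ⟨1000 * 2 ^ k, by positivity, ?_⟩⟩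
  · intro Ω _ μ _ n X _ hX hS
    refine iSup_le fun m => ?_
    rw [Real.enorm_eq_ofReal_abs]
    exact ENNReal.ofReal_le_ofReal ((hX.poissonError_bounds hk hS).1 m)
  · intro Ω _ μ _ n X _ hX hS
    obtain ⟨hsup, S, hsum, hle⟩ := hX.poissonError_bounds hk hS
    have hK : 0 ≤ 1000 * 2 ^ k * n * MultiPoisson.eps1 μ X n :=
      mul_nonneg (by positivity) MultiPoisson.eps1_nonneg
    have hP : 0 < ∏ j, (MultiPoisson.gam μ X n j)⁻¹ :=
      Finset.prod_pos fun j _ => inv_pos.2 (MultiPoisson.gam_pos j)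
    convert MultiPoisson.lNorm_le_of_abs_le_of_hasSum_sq hα hK hP hsup hsum hle using 3
    rw [← Real.finsetProd_rpow _ _ fun j _ => inv_nonneg.2 (MultiPoisson.gam_pos j).le]
    refine Finset.prod_congr rfl fun j _ => ?_
    rw [Real.rpow_neg (MultiPoisson.gam_pos j).le, Real.inv_rpow (MultiPoisson.gam_pos j).le]
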